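/- Let $D\subset\mathbb C^n$ be a bounded domain (nonempty, open, connected) and let $\Omega\subset\mathbb C^n$ be a bounded, convex domain that is balanced, i.e. $\lambda w\in\Omega$ whenever $w\in\Omega$, $\lambda\in\mathbb C$ and $|\lambda|\le 1$. Let $\rho_\Omega(w)=\inf\{t>0:\ w/t\in\Omega\}$ for $w\in\mathbb C^n$ be the Minkowski function of $\Omega$ and, for $0<r\le 1$, put $\Omega(r)=\{w\in\mathbb C^n:\ \rho_\Omega(w)<r\}$, so that $\Omega(1)=\Omega$. For $z\in D$ let $$s_D^\Omega(z)=\sup\{r\in(0,1):\ \Omega(r)\subset f(D)\text{ for some injective holomorphic map } f:D\to\Omega \text{ with } f(z)=0\}$$ be the generalized squeezing function. Then for every $z\in D$ there exists an extremal map at $z$, that is, an injective holomorphic map $f:D\to\Omega$ such that $f(z)=0$ and $\Omega\bigl(s_D^\Omega(z)\bigr)\subset f(D)$. -/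

import Mathlib

open Set

/-- `f` represents an element of `O_u(D, Ω)`: an injective holomorphic map from the open set `D`
into `Ω`. Only the values of `f` on `D` matter. -/
structure IsInjHolo {n : ℕ} (D Ω : Set (EuclideanSpace ℂ (Fin n)))
    (f : EuclideanSpace ℂ (Fin n) → EuclideanSpace ℂ (Fin n)) : Prop where
  differentiableOn : DifferentiableOn ℂ f D
  injOn : InjOn f D
  mapsTo : MapsTo f D Ω

/-- `Ω(r) = {z : ρ_Ω(z) < r}`, where the Minkowski function
`ρ_Ω(z) = inf {t > 0 : z / t ∈ Ω}` is Mathlib's `gauge`. -/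
def minkowskiBall {n : ℕ} (Ω : Set (EuclideanSpace ℂ (Fin n))) (r : ℝ) :
    Set (EuclideanSpace ℂ (Fin n)) :=
  {w | gauge Ω w < r}

/-- The radii `0 < r < 1` with `Ω(r) ⊆ f(D)` for some injective holomorphic `f : D → Ω` with
`f z = 0`. -/
def squeezingRadii {n : ℕ} (D Ω : Set (EuclideanSpace ℂ (Fin n)))
    (z : EuclideanSpace ℂ (Fin n)) : Set ℝ :=
  {r | 0 < r ∧ r < 1 ∧ ∃ f : EuclideanSpace ℂ (Fin n) → EuclideanSpace ℂ (Fin n),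
    IsInjHolo D Ω f ∧ f z = 0 ∧ minkowskiBall Ω r ⊆ f '' D}

/-- The generalized squeezing function `s_D^Ω(z)`. -/
noncomputable def genSqueezing {n : ℕ} (D Ω : Set (EuclideanSpace ℂ (Fin n)))
    (z : EuclideanSpace ℂ (Fin n)) : ℝ :=
  sSup (squeezingRadii D Ω z)

/-- The supremum defining `s_D^Ω(z)` is that of a nonempty set bounded above. -/
theorem isLUB_genSqueezing {n : ℕ} {D Ω : Set (EuclideanSpace ℂ (Fin n))}
    (hDo : IsOpen D) (hDb : Bornology.IsBounded D)
    (hΩo : IsOpen Ω) (hΩn : Ω.Nonempty) (hΩb : Bornology.IsBounded Ω) (hΩbal : Balanced ℂ Ω)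
    {z : EuclideanSpace ℂ (Fin n)} (hz : z ∈ D) :
    IsLUB (squeezingRadii D Ω z) (genSqueezing D Ω z) := by
  refine isLUB_csSup ?_ ⟨1, fun r hr => hr.2.1.le⟩
  have h0 : (0 : EuclideanSpace ℂ (Fin n)) ∈ Ω := by
    obtain ⟨x, hx⟩ := hΩn
    simpa using hΩbal.smul_mem (a := (0 : ℂ)) (by simp) hx
  obtain ⟨a, ha, hball⟩ := Metric.isOpen_iff.1 hΩo 0 h0
  obtain ⟨b, hb, hDsub⟩ := hDb.subset_ball_lt 0 z
  obtain ⟨c, hc, hcD⟩ := Metric.isOpen_iff.1 hDo z hz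
  obtain ⟨R, hR, hΩR⟩ := hΩb.subset_ball_lt 0 0
  have hε : 0 < a / b := div_pos ha hb
  have hεc : ((a / b : ℝ) : ℂ) ≠ 0 := by exact_mod_cast hε.ne'
  have hnorm : ∀ x : EuclideanSpace ℂ (Fin n), ‖((a / b : ℝ) : ℂ) • x‖ = a / b * ‖x‖ := by
    intro x
    rw [norm_smul, Complex.norm_real, Real.norm_of_nonneg hε.le]
  have hr : 0 < min (1 / 2) (a / b * c / R) := by positivity
  refine ⟨min (1 / 2) (a / b * c / R), hr, lt_of_le_of_lt (min_le_left _ _) (by norm_num),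
    fun w => ((a / b : ℝ) : ℂ) • (w - z), ⟨?_, ?_, ?_⟩, by simp, ?_⟩
  · fun_prop
  · intro x _ y _ hxy
    simpa using smul_right_injective _ hεc hxy
  · intro w hw
    apply hball
    have h := hDsub hw
    rw [mem_ball_iff_norm] at h
    rw [mem_ball_zero_iff, hnorm]
    calc a / b * ‖w - z‖ < a / b * b := by gcongr
      _ = a := by field_simp
  · intro w hw
    have hw' : gauge Ω w < a / b * c / R := lt_of_lt_of_le hw (min_le_right _ _)
    have hg : ‖w‖ / R ≤ gauge Ω w := by
      rw [← gauge_ball hR.le]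
      exact gauge_mono (absorbent_nhds_zero (hΩo.mem_nhds h0)) hΩR w
    have hwn : ‖w‖ < a / b * c := (div_lt_div_iff_of_pos_right hR).1 (hg.trans_lt hw')
    refine ⟨z + ((a / b : ℝ) : ℂ)⁻¹ • w, hcD ?_, ?_⟩
    · rw [mem_ball_iff_norm, add_sub_cancel_left, norm_smul, norm_inv, Complex.norm_real,
        Real.norm_of_nonneg hε.le, inv_mul_lt_iff₀ hε]
      exact hwn
    · simp only [add_sub_cancel_left]
      rw [smul_inv_smul₀ hεc]

/-- `f` is an extremal map at `z` for the generalized squeezing function `s_D^Ω`. -/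
structure IsExtremalMap {n : ℕ} (D Ω : Set (EuclideanSpace ℂ (Fin n)))
    (z : EuclideanSpace ℂ (Fin n))
    (f : EuclideanSpace ℂ (Fin n) → EuclideanSpace ℂ (Fin n)) : Prop where
  isInjHolo : IsInjHolo D Ω f
  map_eq_zero : f z = 0
  minkowskiBall_subset : minkowskiBall Ω (genSqueezing D Ω z) ⊆ f '' D

/-! Take admissible maps `F k` whose radii tend to the supremum `s`. They are uniformly bounded, so
by Montel they converge, with their derivatives, to a holomorphic `f` with `f z = 0`. Limits are
taken along an ultrafilter on the indices, which replaces the choice of subsequences.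

The point is that `f` does not degenerate. Fix `0 < r < s`. On `Ω(r)` the inverses of almost all `F
k` are defined and take values in the bounded set `D`, so they converge too, to some `g`. Passing to
the limit in `F k⁻¹ ∘ F k = id` gives `g ∘ f = id` near `z`; hence `f'(z)` and `g'(0)` are
invertible. Hurwitz's theorem, applied to Jacobian determinants, spreads this to all of `D` and
`Ω(r)`, because injective holomorphic maps in equal dimensions have nonvanishing Jacobian (Osgood).
Invertible derivatives make `f` injective and open. They also force `g` to take values in `D`
itself, not just its closure, so `f ∘ g = id` on `Ω(r)` and `Ω(r) ⊆ f(D)`. The union over `r < s` is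
`Ω(s)`. Finally `f(D)` is open in the closure of the convex open set `Ω`, hence lies in `Ω`.

The key lemmas are `injective_fderiv_of_injOn` (Osgood), `ne_zero_of_tendstoContinuouslyOn`
(Hurwitz) and `injective_fderiv_and_subset_image_of_tendstoContinuouslyOn`. -/

open Filter Metric Topology Interval

/-! ### Derivatives of holomorphic maps of several variables are holomorphic. -/

section SeveralVariables

variable {E F : Type*} [NormedAddCommGroup E] [NormedSpace ℂ E] [NormedAddCommGroup F]
  [NormedSpace ℂ F] {f : E → F} {U : Set E}

theorem norm_fderiv_le_of_forall_mem_ball {c : E} {r M : ℝ} (hr : 0 < r)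
    (hd : DifferentiableOn ℂ f (ball c r)) (hM : ∀ x ∈ ball c r, ‖f x‖ ≤ M) :
    ‖fderiv ℂ f c‖ ≤ 2 * M / r := by
  refine Complex.norm_fderiv_le_div_of_mapsTo_ball hd (fun x hx => ?_) hr
  rw [mem_closedBall, dist_eq_norm]
  calc ‖f x - f c‖ ≤ ‖f x‖ + ‖f c‖ := norm_sub_le _ _
    _ ≤ 2 * M := by linarith [hM x hx, hM c (mem_ball_self hr)]

variable [FiniteDimensional ℂ E] [FiniteDimensional ℂ F]

/-- Cauchy's formula on a disc in direction `v` writes the directional derivative as a circle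
integral of values of `f`; this can be differentiated under the integral sign, with Cauchy's
estimate as the dominating bound. -/
theorem differentiableOn_fderiv_apply_const (hf : DifferentiableOn ℂ f U)
    (hU : IsOpen U) (v : E) : DifferentiableOn ℂ (fun x => fderiv ℂ f x v) U := by
  intro x₀ hx₀
  have : CompleteSpace F := FiniteDimensional.complete ℂ F
  have : CompleteSpace E := FiniteDimensional.complete ℂ E
  -- Three radii: base points vary within `r`, the circles around them stay within `2 * r`, and
  -- Cauchy's estimate there needs a further `r`.
  obtain ⟨r, hr, hrU⟩ : ∃ r > 0, ∀ y ∈ ball x₀ (3 * r), y ∈ U ∧ dist (f y) (f x₀) < 1 := by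
    have h1 : ∀ᶠ y in 𝓝 x₀, y ∈ U ∧ dist (f y) (f x₀) < 1 :=
      (hU.eventually_mem hx₀).and
        ((hf.continuousOn.continuousAt (hU.mem_nhds hx₀)).eventually (ball_mem_nhds _ one_pos))
    obtain ⟨r, hr, h⟩ := Metric.eventually_nhds_iff_ball.1 h1
    exact ⟨r / 3, by positivity, by simpa [mul_div_cancel₀] using h⟩
  set M : ℝ := ‖f x₀‖ + 1
  have hM : ∀ y ∈ ball x₀ (3 * r), ‖f y‖ ≤ M := fun y hy => by
    have h1 := (hrU y hy).2
    have h2 := norm_sub_norm_le (f y) (f x₀)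
    rw [dist_eq_norm] at h1
    simp only [M]; linarith
  have hfd : DifferentiableOn ℂ f (ball x₀ (3 * r)) := hf.mono fun y hy => (hrU y hy).1
  have hfd' : ∀ y ∈ ball x₀ (3 * r), DifferentiableAt ℂ f y := fun y hy =>
    hfd.differentiableAt (isOpen_ball.mem_nhds hy)
  have hbd : ∀ y ∈ ball x₀ (2 * r), ‖fderiv ℂ f y‖ ≤ 2 * M / r := fun y hy => by
    have hsub : ball y r ⊆ ball x₀ (3 * r) := ball_subset_ball' (by rw [mem_ball] at hy; linarith)
    exact norm_fderiv_le_of_forall_mem_ball hr (hfd.mono hsub) fun x hx => hM x (hsub hx)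
  set R : ℝ := r / (‖v‖ + 1)
  have hR : 0 < R := by positivity
  have hRv : ∀ z : ℂ, ‖z‖ ≤ R → ‖z • v‖ < r := fun z hz => by
    rw [norm_smul]
    calc ‖z‖ * ‖v‖ ≤ R * ‖v‖ := by gcongr
      _ < R * (‖v‖ + 1) := by gcongr; linarith
      _ = r := by simp only [R]; field_simp
  have hmem : ∀ x ∈ ball x₀ r, ∀ z : ℂ, ‖z‖ ≤ R → x + z • v ∈ ball x₀ (2 * r) := by
    intro x hx z hz
    rw [mem_ball, dist_eq_norm] at *
    calc ‖x + z • v - x₀‖ = ‖(x - x₀) + z • v‖ := by congr 1; abel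
      _ ≤ ‖x - x₀‖ + ‖z • v‖ := norm_add_le _ _
      _ < 2 * r := by linarith [hRv z hz]
  have h23 : ball x₀ (2 * r) ⊆ ball x₀ (3 * r) := ball_subset_ball (by linarith)
  set k : ℝ → ℂ := fun θ => deriv (circleMap 0 R) θ * (1 / (circleMap 0 R θ - 0) ^ 2)
  have hk : Continuous k := by
    simp only [k, deriv_circleMap]
    refine Continuous.mul (by fun_prop) (continuous_const.div (by fun_prop) fun θ => ?_)
    simp [hR.ne']
  have hcm : ∀ θ, ‖circleMap 0 R θ‖ ≤ R := fun θ => by simp [abs_of_pos hR]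
  set G : E → ℝ → F := fun x θ => k θ • f (x + circleMap 0 R θ • v)
  have hint : ∀ x ∈ ball x₀ r, Continuous (G x) := fun x hx => by
    refine hk.smul (continuous_iff_continuousAt.2 fun θ => ?_)
    exact ContinuousAt.comp (g := f) (hfd' _ (h23 (hmem x hx _ (hcm θ)))).continuousAt (by fun_prop)
  have heq : ∀ x ∈ ball x₀ r,
      fderiv ℂ f x v = (2 * Real.pi * Complex.I)⁻¹ • ∫ θ in (0)..(2 * Real.pi), G x θ := by
    intro x hx
    have hg : DifferentiableOn ℂ (fun z : ℂ => f (x + z • v)) (closedBall 0 R) := fun z hz => by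
      have hz' : ‖z‖ ≤ R := by simpa using hz
      have := (hfd' _ (h23 (hmem x hx z hz'))).comp z
        (f := fun z : ℂ => x + z • v) (by fun_prop)
      exact this.differentiableWithinAt
    have h1 := hg.deriv_eq_smul_circleIntegral hR
    have h2 : HasDerivAt (fun z : ℂ => f (x + z • v)) (fderiv ℂ f x v) 0 := by
      have h3 : HasDerivAt (fun z : ℂ => x + z • v) v 0 := by
        simpa using ((hasDerivAt_id (0 : ℂ)).smul_const v).const_add x
      have h4 : HasFDerivAt f (fderiv ℂ f x) (x + (0 : ℂ) • v) := by
        simpa using (hfd' x (ball_subset_ball (by linarith) hx)).hasFDerivAt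
      exact h4.comp_hasDerivAt 0 h3
    rw [h2.deriv] at h1
    rw [eq_inv_smul_iff₀ (by simp [Real.pi_ne_zero]), ← h1, circleIntegral]
    simp only [G, k, smul_smul]
  -- Continuity of the derivative is not yet known, but a derivative is always measurable.
  have hmeas : MeasureTheory.AEStronglyMeasurable
      (fun θ => k θ • fderiv ℂ f (x₀ + circleMap 0 R θ • v))
      (MeasureTheory.volume.restrict (Ι 0 (2 * Real.pi))) := by
    borelize E
    borelize (E →L[ℂ] F)
    have : ProperSpace (E →L[ℂ] F) := FiniteDimensional.proper ℂ _
    refine hk.aestronglyMeasurable.smul (Measurable.aestronglyMeasurable ?_)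
    exact (measurable_fderiv ℂ f).comp (by fun_prop : Continuous _).measurable
  have hx₀r : ball x₀ r ∈ 𝓝 x₀ := ball_mem_nhds _ hr
  have key := intervalIntegral.hasFDerivAt_integral_of_dominated_of_fderiv_le (𝕜 := ℂ)
    (μ := MeasureTheory.volume) (a := 0) (b := 2 * Real.pi) (F := G)
    (F' := fun x θ => k θ • fderiv ℂ f (x + circleMap 0 R θ • v))
    (bound := fun θ => ‖k θ‖ * (2 * M / r)) hx₀r
    (eventually_of_mem hx₀r fun x hx => (hint x hx).aestronglyMeasurable)
    ((hint x₀ (mem_ball_self hr)).intervalIntegrable _ _) hmeas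
    (Eventually.of_forall fun θ _ x hx => by
      rw [norm_smul]
      gcongr
      exact hbd _ (hmem x hx _ (hcm θ)))
    ((by fun_prop : Continuous fun θ => ‖k θ‖ * (2 * M / r)).intervalIntegrable _ _)
    (Eventually.of_forall fun θ _ x hx => by
      have h1 := (hfd' _ (h23 (hmem x hx _ (hcm θ)))).hasFDerivAt.comp x
        ((hasFDerivAt_id x).add_const (circleMap 0 R θ • v))
      exact (h1.const_smul (k θ)))
  refine DifferentiableAt.differentiableWithinAt ?_
  refine (key.differentiableAt.const_smul ((2 * Real.pi * Complex.I : ℂ)⁻¹)).congr_of_eventuallyEq ?_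
  exact eventually_of_mem hx₀r heq

theorem differentiableOn_fderiv_of_isOpen (hf : DifferentiableOn ℂ f U) (hU : IsOpen U) :
    DifferentiableOn ℂ (fderiv ℂ f) U := by
  let e₁ : E ≃L[ℂ] (Fin (Module.finrank ℂ E) → ℂ) :=
    ContinuousLinearEquiv.ofFinrankEq (by simp)
  let e₂ := (e₁.arrowCongr (1 : F ≃L[ℂ] F)).trans
    (ContinuousLinearEquiv.piRing (Fin (Module.finrank ℂ E)))
  rw [← Function.id_comp (fderiv ℂ f), ← e₂.symm_comp_self]
  exact e₂.symm.differentiable.comp_differentiableOn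
    (differentiableOn_pi.2 fun i => differentiableOn_fderiv_apply_const hf hU _)

theorem DifferentiableOn.contDiffOn_one_of_isOpen (hf : DifferentiableOn ℂ f U) (hU : IsOpen U) :
    ContDiffOn ℂ 1 f U :=
  (contDiffOn_succ_iff_fderiv_of_isOpen (n := 0) hU).2
    ⟨hf, by simp, contDiffOn_zero.2 (differentiableOn_fderiv_of_isOpen hf hU).continuousOn⟩

theorem DifferentiableOn.contDiffAt_one (hf : DifferentiableOn ℂ f U) (hU : IsOpen U) {x : E}
    (hx : x ∈ U) : ContDiffAt ℂ 1 f x :=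
  (hf.contDiffOn_one_of_isOpen hU).contDiffAt (hU.mem_nhds hx)

end SeveralVariables

/-! ### Continuous convergence. -/

section ContinuousConvergence

variable {ι X Y Z : Type*} [TopologicalSpace X] [TopologicalSpace Y] [TopologicalSpace Z]

/-- Continuous convergence of a family of functions at every point of `U`: for continuous limits
and open `U` in a locally compact space this is locally uniform convergence on `U`. -/
def TendstoContinuouslyOn (F : ι → X → Y) (f : X → Y) (l : Filter ι) (U : Set X) : Prop :=
  ∀ x ∈ U, Tendsto (fun p : ι × X => F p.1 p.2) (l ×ˢ 𝓝 x) (𝓝 (f x))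

variable {F : ι → X → Y} {f : X → Y} {l : Filter ι} {U : Set X}

theorem TendstoContinuouslyOn.tendsto_of_tendsto (h : TendstoContinuouslyOn F f l U) {x : X}
    (hx : x ∈ U) {u : ι → X} (hu : Tendsto u l (𝓝 x)) :
    Tendsto (fun k => F k (u k)) l (𝓝 (f x)) :=
  (h x hx).comp (tendsto_id.prodMk hu)

theorem TendstoContinuouslyOn.tendsto (h : TendstoContinuouslyOn F f l U) {x : X}
    (hx : x ∈ U) : Tendsto (fun k => F k x) l (𝓝 (f x)) :=
  h.tendsto_of_tendsto hx tendsto_const_nhds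

theorem TendstoContinuouslyOn.continuous_comp (h : TendstoContinuouslyOn F f l U) {g : Y → Z}
    (hg : Continuous g) : TendstoContinuouslyOn (fun k x => g (F k x)) (fun x => g (f x)) l U :=
  fun x hx => (hg.tendsto _).comp (h x hx)

theorem TendstoContinuouslyOn.comp_continuousOn {V : Set Z} {g : Z → X}
    (h : TendstoContinuouslyOn F f l U) (hg : ∀ z ∈ V, ContinuousAt g z) (hV : MapsTo g V U) :
    TendstoContinuouslyOn (fun k z => F k (g z)) (fun z => f (g z)) l V :=
  fun z hz => (h (g z) (hV hz)).comp (tendsto_id.prodMap (hg z hz))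

theorem TendstoContinuouslyOn.continuousAt {Y : Type*} [PseudoMetricSpace Y] [l.NeBot]
    {F : ι → X → Y} {f : X → Y} (h : TendstoContinuouslyOn F f l U) (hU : IsOpen U) {x : X}
    (hx : x ∈ U) : ContinuousAt f x := by
  refine Metric.continuousAt_iff'.2 fun ε hε => ?_
  obtain ⟨p, hp, q, hq, hpq⟩ := eventually_prod_iff.1
    ((h x hx).eventually (ball_mem_nhds (f x) (half_pos hε)))
  filter_upwards [hq, hU.mem_nhds hx] with y hy hyU
  have h1 : dist (f y) (f x) ≤ ε / 2 :=
    le_of_tendsto ((h.tendsto hyU).dist tendsto_const_nhds) (hp.mono fun k hk => (hpq hk hy).le)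
  linarith

end ContinuousConvergence

/-! ### Montel's theorem along an ultrafilter. -/

section Montel

variable {ι E G : Type*} [NormedAddCommGroup E] [NormedSpace ℂ E] [NormedAddCommGroup G]
  [NormedSpace ℂ G] [FiniteDimensional ℂ G] {U : Set E} {F : ι → E → G}

/-- The pointwise part of Montel's theorem along an ultrafilter. -/
theorem exists_tendstoContinuouslyOn_of_locally_bounded (l : Ultrafilter ι)
    (hF : ∀ k, DifferentiableOn ℂ (F k) U)
    (hb : ∀ x ∈ U, ∃ r > 0, ball x r ⊆ U ∧ ∃ M : ℝ, ∀ k, ∀ y ∈ ball x r, ‖F k y‖ ≤ M) :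
    ∃ f : E → G, TendstoContinuouslyOn F f l U := by
  have : ProperSpace G := FiniteDimensional.proper ℂ G
  have hlim : ∀ x ∈ U, ∃ y, Tendsto (fun k => F k x) l (𝓝 y) := fun x hx => by
    obtain ⟨r, hr, -, M, hM⟩ := hb x hx
    obtain ⟨y, -, hy⟩ := (isCompact_closedBall (0 : G) M).ultrafilter_le_nhds
      (l.map fun k => F k x) (by
        rw [le_principal_iff]
        exact Filter.mem_map.2 (Eventually.of_forall fun k => by
          simpa using hM k x (mem_ball_self hr)))
    exact ⟨y, hy⟩
  choose! f hf using hlim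
  refine ⟨f, fun x hx => ?_⟩
  obtain ⟨r, hr, hrU, M, hM⟩ := hb x hx
  rw [tendsto_iff_dist_tendsto_zero]
  -- The Schwarz lemma gives the whole family one Lipschitz constant at `x`, which upgrades
  -- pointwise to continuous convergence.
  have h1 : Tendsto (fun p : ι × E => 2 * M / r * dist p.2 x + dist (F p.1 x) (f x))
      (l ×ˢ 𝓝 x) (𝓝 0) := by
    have h2 : Tendsto (fun p : ι × E => dist p.2 x) (l ×ˢ 𝓝 x) (𝓝 0) :=
      (tendsto_iff_dist_tendsto_zero.1 tendsto_id).comp tendsto_snd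
    have h3 : Tendsto (fun p : ι × E => dist (F p.1 x) (f x)) (l ×ˢ 𝓝 x) (𝓝 0) :=
      (tendsto_iff_dist_tendsto_zero.1 (hf x hx)).comp tendsto_fst
    simpa using (h2.const_mul (2 * M / r)).add h3
  refine squeeze_zero' (Eventually.of_forall fun _ => dist_nonneg) ?_ h1
  filter_upwards [tendsto_snd.eventually (ball_mem_nhds x hr)] with p hp
  refine (dist_triangle _ (F p.1 x) _).trans ?_
  gcongr
  refine Complex.dist_le_div_mul_dist_of_mapsTo_ball ((hF p.1).mono hrU) (fun y hy => ?_) hp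
  rw [mem_closedBall, dist_eq_norm]
  calc ‖F p.1 y - F p.1 x‖ ≤ ‖F p.1 y‖ + ‖F p.1 x‖ := norm_sub_le _ _
    _ ≤ 2 * M := by linarith [hM p.1 y hy, hM p.1 x (mem_ball_self hr)]

/-- Montel's theorem along an ultrafilter, with convergence of the derivatives. -/
theorem exists_tendstoContinuouslyOn_fderiv [FiniteDimensional ℂ E] (l : Ultrafilter ι)
    (hU : IsOpen U) (hF : ∀ k, DifferentiableOn ℂ (F k) U) {M : ℝ}
    (hb : ∀ k, ∀ x ∈ U, ‖F k x‖ ≤ M) :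
    ∃ f : E → G, DifferentiableOn ℂ f U ∧ TendstoContinuouslyOn F f l U ∧
      TendstoContinuouslyOn (fun k => fderiv ℂ (F k)) (fderiv ℂ f) l U := by
  obtain ⟨f, hf⟩ := exists_tendstoContinuouslyOn_of_locally_bounded l hF fun x hx => by
    obtain ⟨r, hr, hrU⟩ := Metric.isOpen_iff.1 hU x hx
    exact ⟨r, hr, hrU, M, fun k y hy => hb k y (hrU hy)⟩
  obtain ⟨f', hf'⟩ := exists_tendstoContinuouslyOn_of_locally_bounded l
    (fun k => differentiableOn_fderiv_of_isOpen (hF k) hU) fun x hx => by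
    obtain ⟨r, hr, hrU⟩ := Metric.isOpen_iff.1 hU x hx
    refine ⟨r / 2, by positivity, (ball_subset_ball (by linarith)).trans hrU, 2 * M / (r / 2),
      fun k y hy => ?_⟩
    have hsub : ball y (r / 2) ⊆ U :=
      (ball_subset_ball' (by rw [mem_ball] at hy; linarith)).trans hrU
    exact norm_fderiv_le_of_forall_mem_ball (by positivity) ((hF k).mono hsub)
      fun z hz => hb k z (hsub hz)
  have hd : ∀ x ∈ U, HasFDerivAt f (f' x) x := fun x hx => by
    refine hasFDerivAt_of_tendstoUniformlyOnFilter (l := (l : Filter ι))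
      (f' := fun k => fderiv ℂ (F k)) ?_ ?_ (eventually_of_mem (hU.mem_nhds hx) fun y hy =>
        hf.tendsto hy)
    · refine Metric.tendstoUniformlyOnFilter_iff.2 fun ε hε => ?_
      filter_upwards [(hf' x hx).eventually (ball_mem_nhds _ (half_pos hε)), tendsto_snd.eventually
        ((hf'.continuousAt hU hx).eventually (ball_mem_nhds _ (half_pos hε)))] with p h1 h2
      have h3 := dist_triangle_right (f' p.2) (fderiv ℂ (F p.1) p.2) (f' x)
      linarith
    · filter_upwards [tendsto_snd.eventually (hU.mem_nhds hx)] with p hp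
      exact ((hF p.1).differentiableAt (hU.mem_nhds hp)).hasFDerivAt
  refine ⟨f, fun x hx => (hd x hx).differentiableAt.differentiableWithinAt, hf, fun x hx => ?_⟩
  rw [(hd x hx).fderiv]
  exact hf' x hx

end Montel

/-! ### Hurwitz's theorem. -/

section Hurwitz

/-- Otherwise `1 / φ` would violate the maximum principle at the centre. -/
theorem exists_zero_of_norm_lt_of_le_sphere {φ : ℂ → ℂ} {c : ℂ} {r m : ℝ} (hr : 0 < r)
    (hφ : DiffContOnCl ℂ φ (ball c r)) (hm : ∀ z ∈ sphere c r, m ≤ ‖φ z‖) (hc : ‖φ c‖ < m) :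
    ∃ z ∈ closedBall c r, φ z = 0 := by
  by_contra! h
  have hm0 : 0 < m := (norm_nonneg _).trans_lt hc
  have h1 : DiffContOnCl ℂ (fun z => (φ z)⁻¹) (ball c r) :=
    hφ.inv fun z hz => h z (by rwa [closure_ball c hr.ne'] at hz)
  have h2 := Complex.norm_le_of_forall_mem_frontier_norm_le isBounded_ball h1 (C := m⁻¹)
    (fun z hz => by
      rw [frontier_ball c hr.ne'] at hz
      rw [norm_inv]
      exact inv_anti₀ hm0 (hm z hz)) (subset_closure (mem_ball_self hr))
  rw [norm_inv] at h2
  exact absurd ((inv_le_inv₀ (norm_pos_iff.2 (h c (mem_closedBall_self hr.le))) hm0).1 h2)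
    (not_le.2 hc)

variable {ι : Type*} {l : Filter ι}

theorem eventually_exists_zero_of_tendstoContinuouslyOn {G : ι → ℂ → ℂ} {g : ℂ → ℂ} {c : ℂ}
    {r : ℝ} (hr : 0 < r) (hG : ∀ᶠ k in l, DiffContOnCl ℂ (G k) (ball c r))
    (hGg : TendstoContinuouslyOn G g l (closedBall c r)) (hg : ContinuousOn g (sphere c r))
    (hs : ∀ z ∈ sphere c r, g z ≠ 0) (hc : g c = 0) :
    ∀ᶠ k in l, ∃ z ∈ closedBall c r, G k z = 0 := by
  obtain ⟨z₀, hz₀, hmin⟩ := (isCompact_sphere c r).exists_isMinOn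
    (NormedSpace.sphere_nonempty.2 hr.le) hg.norm
  set δ := ‖g z₀‖
  have hδ : 0 < δ := norm_pos_iff.2 (hs z₀ hz₀)
  have h1 : ∀ᶠ k in l, ∀ z ∈ sphere c r, δ / 2 ≤ ‖G k z‖ := by
    have h5 : ∀ z ∈ sphere c r, ∀ᶠ p in l ×ˢ 𝓝 z, δ / 2 ≤ ‖G p.1 p.2‖ := fun z hz => by
      have h2 : δ ≤ ‖g z‖ := hmin hz
      exact ((hGg z (sphere_subset_closedBall hz)).norm.eventually_const_lt
        (by linarith)).mono fun p hp => hp.le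
    have h4 : ∀ᶠ p in l ×ˢ 𝓝ˢ (sphere c r), δ / 2 ≤ ‖G p.1 p.2‖ := by
      simp only [(isCompact_sphere c r).prod_nhdsSet_eq_biSup, eventually_iSup]
      exact h5
    exact h4.curry.mono fun _ h => h.self_of_nhdsSet
  have h3 : ∀ᶠ k in l, ‖G k c‖ < δ / 2 :=
    (hGg.tendsto (mem_closedBall_self hr.le)).norm.eventually_lt_const (by simp [hc, hδ])
  filter_upwards [hG, h1, h3] with k hk h1k h3k
  exact exists_zero_of_norm_lt_of_le_sphere hr hk h1k h3k

/-- Hurwitz's theorem: a limit of zero-free holomorphic functions of several variables on a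
connected open set has no zeros unless it vanishes identically. -/
theorem ne_zero_of_tendstoContinuouslyOn {E : Type*} [NormedAddCommGroup E] [NormedSpace ℂ E]
    [l.NeBot] {U : Set E} {F : ι → E → ℂ} {h : E → ℂ} (hU : IsOpen U) (hUc : IsPreconnected U)
    (hF : ∀ k, DifferentiableOn ℂ (F k) U) (hF0 : ∀ᶠ k in l, ∀ x ∈ U, F k x ≠ 0)
    (hh : DifferentiableOn ℂ h U) (hFh : TendstoContinuouslyOn F h l U) {x₀ : E} (hx₀ : x₀ ∈ U)
    (hhx₀ : h x₀ ≠ 0) : ∀ x ∈ U, h x ≠ 0 := by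
  have hopen : IsOpen (U ∩ {x | h x ≠ 0}) :=
    hh.continuousOn.isOpen_inter_preimage hU isOpen_ne
  suffices hsub : U ⊆ U ∩ {x | h x ≠ 0} from fun x hx => (hsub hx).2
  refine hUc.subset_of_closure_inter_subset hopen ⟨x₀, hx₀, hx₀, hhx₀⟩ ?_
  -- At a zero `a` in the closure of the nonvanishing set, restrict to the complex line through `a`
  -- and a nearby `b` with `h b ≠ 0`: there `a` is an isolated zero, and one-variable Hurwitz
  -- applies.
  rintro a ⟨hacl, haU⟩
  refine ⟨haU, fun ha0 => ?_⟩
  obtain ⟨r, hr, hrU⟩ := Metric.isOpen_iff.1 hU a haU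
  obtain ⟨b, ⟨-, hb0⟩, hab⟩ := Metric.mem_closure_iff.1 hacl r hr
  have hne : 0 < ‖b - a‖ := norm_pos_iff.2 (sub_ne_zero.2 fun hba => hb0 (hba ▸ ha0))
  set R := r / ‖b - a‖
  have hR1 : 1 < R := (one_lt_div hne).2 (by rwa [dist_comm, dist_eq_norm] at hab)
  have hmap : MapsTo (fun t : ℂ => a + t • (b - a)) (ball 0 R) U := fun t ht => hrU <| by
    have ht' : ‖t‖ < R := by simpa using ht
    simpa [norm_smul] using (lt_div_iff₀ hne).1 ht'
  have hgd : DifferentiableOn ℂ (fun t : ℂ => h (a + t • (b - a))) (ball 0 R) :=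
    hh.comp (by fun_prop) hmap
  have hga := hgd.analyticOnNhd isOpen_ball
  have h0R : (0 : ℂ) ∈ ball (0 : ℂ) R := mem_ball_self (by linarith)
  have hev : ∀ᶠ t in 𝓝[≠] (0 : ℂ), h (a + t • (b - a)) ≠ 0 := by
    refine (hga 0 h0R).eventually_eq_zero_or_eventually_ne_zero.resolve_left fun hz => hb0 ?_
    simpa using hga.eqOn_zero_of_preconnected_of_eventuallyEq_zero
      (convex_ball _ _).isPreconnected h0R hz (show (1 : ℂ) ∈ ball (0 : ℂ) R by simpa using hR1)
  obtain ⟨ε, hε, hεs⟩ := Metric.eventually_nhds_iff_ball.1 (eventually_nhdsWithin_iff.1 hev)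
  set ρ := min (ε / 2) (R / 2)
  have hρ : 0 < ρ := by positivity
  have hρR : closedBall (0 : ℂ) ρ ⊆ ball 0 R := closedBall_subset_ball
    ((min_le_right _ _).trans_lt (by linarith))
  have hρε : closedBall (0 : ℂ) ρ ⊆ ball 0 ε := closedBall_subset_ball
    ((min_le_left _ _).trans_lt (by linarith))
  have hzero : ∀ᶠ k in l, ∃ z ∈ closedBall (0 : ℂ) ρ, F k (a + z • (b - a)) = 0 := by
    refine eventually_exists_zero_of_tendstoContinuouslyOn
      (G := fun k z => F k (a + z • (b - a))) (g := fun z => h (a + z • (b - a))) hρ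
      (Eventually.of_forall fun k => ?_) (hFh.comp_continuousOn (fun z _ => by fun_prop)
        (hmap.mono_left hρR)) (hgd.continuousOn.mono (sphere_subset_closedBall.trans hρR))
      (fun z hz => hεs z (hρε (sphere_subset_closedBall hz)) (ne_of_mem_sphere hz hρ.ne'))
      (by simpa using ha0)
    refine DifferentiableOn.diffContOnCl ?_
    rw [closure_ball _ hρ.ne']
    exact (hF k).comp (by fun_prop) (hmap.mono_left hρR)
  obtain ⟨k, ⟨z, hz, hkz⟩, hk0⟩ := (hzero.and hF0).exists
  exact hk0 _ (hmap (hρR hz)) hkz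

end Hurwitz

/-! ### Stability of attained values under convergence. -/

section LocalSurjectivity

variable {E F : Type*} [NormedAddCommGroup E] [NormedSpace ℂ E] [NormedAddCommGroup F]
  [NormedSpace ℂ F] [FiniteDimensional ℂ E] [FiniteDimensional ℂ F]

theorem ContinuousLinearMap.exists_equiv_of_injective (A : E →L[ℂ] F)
    (hA : Function.Injective A) (hd : Module.finrank ℂ E = Module.finrank ℂ F) :
    ∃ B : E ≃L[ℂ] F, (B : E →L[ℂ] F) = A :=
  ⟨(LinearEquiv.ofInjectiveOfFinrankEq (A : E →ₗ[ℂ] F) hA hd).toContinuousLinearEquiv, by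
    ext x; rfl⟩

variable {ι : Type*} {l : Filter ι}

/-- A value taken by the limit at a point with invertible derivative is taken nearby by the
functions of the family. -/
theorem eventually_mem_image_of_tendstoContinuouslyOn {G : ι → E → E} {g : E → E} {U V : Set E}
    (hU : IsOpen U) (hG : ∀ k, DifferentiableOn ℂ (G k) U) (hGg : TendstoContinuouslyOn G g l U)
    (hGg' : TendstoContinuouslyOn (fun k => fderiv ℂ (G k)) (fderiv ℂ g) l U) {p : E}
    (hp : p ∈ U) (hinj : Function.Injective (fderiv ℂ g p)) (hV : V ∈ 𝓝 p) :
    ∀ᶠ k in l, g p ∈ G k '' V := by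
  have : CompleteSpace E := FiniteDimensional.complete ℂ E
  obtain ⟨B, hB⟩ := (fderiv ℂ g p).exists_equiv_of_injective hinj rfl
  set N := (B : E →L[ℂ] E).nonlinearRightInverseOfSurjective
    (LinearMap.range_eq_top.2 B.surjective)
  have hN : 0 < N.nnnorm := ContinuousLinearMap.nonlinearRightInverseOfSurjective_nnnorm_pos _ _
  -- Half the critical constant, so that `N.nnnorm⁻¹ - c = c` and the image of the `ε`-ball covers a
  -- ball of radius `c * ε`.
  set c := N.nnnorm⁻¹ / 2
  have hc : 0 < c := by positivity
  obtain ⟨P, hP, Q, hQ, hPQ⟩ := eventually_prod_iff.1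
    ((hGg' p hp).eventually (closedBall_mem_nhds _ (NNReal.coe_pos.2 hc)))
  obtain ⟨ε, hε, hεs⟩ := nhds_basis_closedBall.mem_iff.1
    (inter_mem (inter_mem hQ hV) (hU.mem_nhds hp))
  have hclose : ∀ᶠ k in l, dist (g p) (G k p) < c * ε := by
    have := (hGg.tendsto hp).eventually (ball_mem_nhds _ (show 0 < (c : ℝ) * ε by positivity))
    exact this.mono fun k hk => by rwa [dist_comm]
  filter_upwards [hP, hclose] with k hk hck
  have happ : ApproximatesLinearOn (G k) (B : E →L[ℂ] E) (closedBall p ε) c := by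
    intro x hx y hy
    refine (convex_closedBall p ε).norm_image_sub_le_of_norm_hasFDerivWithin_le' (𝕜 := ℂ)
      (f' := fderiv ℂ (G k))
      (fun z hz => ((hG k).differentiableAt
        (hU.mem_nhds (hεs hz).2)).hasFDerivAt.hasFDerivWithinAt) (fun z hz => ?_) hy hx
    have h1 := hPQ hk (hεs hz).1.1
    rwa [dist_eq_norm, ← hB] at h1
  have hsurj := happ.surjOn_closedBall_of_nonlinearRightInverse N hε.le subset_rfl
  have hcN : ((N.nnnorm : ℝ)⁻¹ - c) = c := by
    simp only [c]; push_cast; ring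
  obtain ⟨x, hx, hxe⟩ := hsurj (show g p ∈ _ by rw [hcN]; exact mem_closedBall.2 hck.le)
  exact ⟨x, (hεs hx).1.2, hxe⟩

end LocalSurjectivity

/-! ### Ingredients of Osgood's theorem. -/

section Osgood

theorem ContinuousLinearMap.differentiable_det {E : Type*} [NormedAddCommGroup E]
    [NormedSpace ℂ E] [FiniteDimensional ℂ E] :
    Differentiable ℂ (fun L : E →L[ℂ] E => LinearMap.det (L : E →ₗ[ℂ] E)) := by
  classical
  let b := Module.finBasis ℂ E
  have hentry : ∀ i j, Differentiable ℂ
      (fun L : E →L[ℂ] E => LinearMap.toMatrix b b (L : E →ₗ[ℂ] E) i j) := fun i j => by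
    simp only [LinearMap.toMatrix_apply]
    have h1 : Differentiable ℂ (fun L : E →L[ℂ] E => L (b j)) := by fun_prop
    exact (LinearMap.toContinuousLinearMap (b.coord i)).differentiable.comp h1
  simp_rw [← LinearMap.det_toMatrix b, Matrix.det_apply]
  fun_prop

theorem ContinuousLinearMap.det_ne_zero_iff_injective {E : Type*} [NormedAddCommGroup E]
    [NormedSpace ℂ E] [FiniteDimensional ℂ E] (L : E →L[ℂ] E) :
    LinearMap.det (L : E →ₗ[ℂ] E) ≠ 0 ↔ Function.Injective L := by
  rw [← isUnit_iff_ne_zero, ← LinearMap.isUnit_iff_isUnit_det, LinearMap.isUnit_iff_ker_eq_bot,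
    LinearMap.ker_eq_bot]
  rfl

theorem exists_mem_ball_ne {E : Type*} [NormedAddCommGroup E] [NormedSpace ℂ E] [Nontrivial E]
    (a : E) {r : ℝ} (hr : 0 < r) : ∃ y ∈ ball a r, y ≠ a := by
  have : (𝓝[≠] a).NeBot := Module.punctured_nhds_neBot ℂ E a
  obtain ⟨y, hya, hy⟩ := this.nonempty_of_mem (inter_mem_nhdsWithin {a}ᶜ (ball_mem_nhds a hr))
  exact ⟨y, hy, hya⟩

/-- Local coordinates in which a holomorphic function with nonzero derivative is affine. -/
theorem exists_straightening {E : Type*} [NormedAddCommGroup E] [NormedSpace ℂ E]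
    [FiniteDimensional ℂ E] {φ : E → ℂ} {U : Set E} (hU : IsOpen U)
    (hφ : DifferentiableOn ℂ φ U) {a e : E} (ha : a ∈ U) (he : fderiv ℂ φ a e ≠ 0) :
    ∃ (ψ : E → E) (W : Set E), IsOpen W ∧ a ∈ W ∧ DifferentiableOn ℂ ψ W ∧ MapsTo ψ W U ∧
      InjOn ψ W ∧ ψ a = a ∧ HasFDerivAt ψ (ContinuousLinearMap.id ℂ E) a ∧
      ∀ y ∈ W, φ (ψ y) = φ a + fderiv ℂ φ a (y - a) := by
  have : CompleteSpace E := FiniteDimensional.complete ℂ E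
  set ℓ := fderiv ℂ φ a
  -- The correction along `e` is chosen so that `ℓ (Φ x - a) = φ x - φ a`; it vanishes to first
  -- order at `a`. The coordinates are the local inverse of `Φ`.
  set Φ : E → E := fun x => x + ((ℓ e)⁻¹ * (φ x - φ a - ℓ (x - a))) • e
  have hΦd : DifferentiableOn ℂ Φ U := by fun_prop
  have hφa : HasFDerivAt φ ℓ a := (hφ.differentiableAt (hU.mem_nhds ha)).hasFDerivAt
  have hΦa : Φ a = a := by simp [Φ]
  have hΦ' : HasFDerivAt Φ (ContinuousLinearEquiv.refl ℂ E : E →L[ℂ] E) a := by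
    have h1 : HasFDerivAt (fun x => φ x - φ a - ℓ (x - a)) (ℓ - ℓ) a :=
      (hφa.sub_const _).sub (ℓ.hasFDerivAt.comp a ((hasFDerivAt_id a).sub_const a))
    have h2 := (hasFDerivAt_id a).add ((h1.const_mul (ℓ e)⁻¹).smul_const e)
    have h3 : (ContinuousLinearEquiv.refl ℂ E : E →L[ℂ] E) =
        ContinuousLinearMap.id ℂ E + ((ℓ e)⁻¹ • (ℓ - ℓ)).smulRight e := by
      ext x; simp
    rw [h3]
    exact h2
  have hc : ContDiffAt ℂ 1 Φ a := hΦd.contDiffAt_one hU ha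
  set P := hc.toOpenPartialHomeomorph Φ hΦ' one_ne_zero
  have hP : ∀ x, P x = Φ x := fun x => rfl
  have haP : a ∈ P.source := hc.mem_toOpenPartialHomeomorph_source hΦ' one_ne_zero
  have hat : a ∈ P.target := by
    have := P.map_source haP
    rwa [hP, hΦa] at this
  have hsa : P.symm a = a := by
    have := P.left_inv haP
    rwa [hP, hΦa] at this
  have hcs : ContDiffAt ℂ 1 P.symm a :=
    P.contDiffAt_symm hat (f₀' := ContinuousLinearEquiv.refl ℂ E) (by rw [hsa]; exact hΦ')
      (by rw [hsa]; exact hc)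
  have hev : ∀ᶠ y in 𝓝 a, y ∈ P.target ∧ DifferentiableAt ℂ P.symm y ∧ P.symm y ∈ U :=
    (P.open_target.eventually_mem hat).and (((hcs.eventually (by simp)).mono fun y hy =>
      hy.differentiableAt (by simp)).and (hcs.continuousAt.eventually_mem (by
        rw [hsa]; exact hU.mem_nhds ha)))
  obtain ⟨W, hW, hWo, haW⟩ := _root_.eventually_nhds_iff.1 hev
  refine ⟨P.symm, W, hWo, haW, fun y hy => (hW y hy).2.1.differentiableWithinAt,
    fun y hy => (hW y hy).2.2, P.symm.injOn.mono fun y hy => (hW y hy).1, hsa, ?_, fun y hy => ?_⟩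
  · exact P.hasFDerivAt_symm hat (f' := ContinuousLinearEquiv.refl ℂ E) (by rw [hsa]; exact hΦ')
  · have h1 : Φ (P.symm y) = y := P.right_inv (hW y hy).1
    have h2 := congrArg ℓ h1
    simp only [Φ, map_add, map_smul, smul_eq_mul, map_sub] at h2 ⊢
    field_simp at h2
    linear_combination h2

/-- The inverse is continuous by the open mapping theorem and holomorphic off the isolated critical
values, hence holomorphic by removability; the chain rule then excludes `f'(a) = 0`. -/
theorem deriv_ne_zero_of_injOn {f : ℂ → ℂ} {U : Set ℂ} (hU : IsOpen U)
    (hf : DifferentiableOn ℂ f U) (hinj : InjOn f U) {a : ℂ} (ha : a ∈ U) : deriv f a ≠ 0 := by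
  intro h0
  have hfa := hf.analyticOnNhd hU
  set g := Function.invFunOn f U
  have hgf : ∀ x ∈ U, g (f x) = x := fun x hx => hinj.leftInvOn_invFunOn hx
  have hopen : ∀ x ∈ U, 𝓝 (f x) ≤ map f (𝓝 x) := fun x hx => by
    refine (hfa x hx).eventually_constant_or_nhds_le_map_nhds_aux.resolve_left fun hc => ?_
    have h1 : ∀ᶠ y in 𝓝 x, y = x := by
      filter_upwards [hc, hU.mem_nhds hx] with y hy hyU using hinj hyU hx hy
    have h2 : ∀ᶠ y in 𝓝[≠] x, False :=
      eventually_nhdsWithin_iff.2 (h1.mono fun y hy hne => hne hy)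
    exact h2.exists.elim fun _ h => h
  have hgc : ∀ x ∈ U, ContinuousAt g (f x) := fun x hx => by
    rw [ContinuousAt, hgf x hx]
    refine (tendsto_map'_iff.2 ?_).mono_left (hopen x hx)
    exact tendsto_id.congr' (eventually_of_mem (hU.mem_nhds hx) fun y hy => (hgf y hy).symm)
  have hgd : ∀ x ∈ U, deriv f x ≠ 0 → DifferentiableAt ℂ g (f x) := fun x hx hx0 =>
    ((hfa x hx).hasStrictDerivAt.to_local_left_inverse hx0
      (eventually_of_mem (hU.mem_nhds hx) hgf)).hasDerivAt.differentiableAt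
  have hpunct : ∀ᶠ x in 𝓝[≠] a, deriv f x ≠ 0 := by
    refine (hfa a ha).deriv.eventually_eq_zero_or_eventually_ne_zero.resolve_left fun hz => ?_
    obtain ⟨r, hr, hrs⟩ := Metric.eventually_nhds_iff_ball.1 (hz.and (hU.mem_nhds ha))
    have hconst : ∀ y ∈ ball a r, f y = f a := fun y hy =>
      isOpen_ball.is_const_of_deriv_eq_zero (convex_ball a r).isPreconnected
        (hf.mono fun z hz => (hrs z hz).2) (fun z hz => (hrs z hz).1) hy (mem_ball_self hr)
    have h1 : ∀ᶠ y in 𝓝[≠] a, False := by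
      refine eventually_nhdsWithin_iff.2 (eventually_of_mem (ball_mem_nhds a hr) fun y hy hne => ?_)
      exact hne (hinj (hrs y hy).2 ha (hconst y hy))
    exact h1.exists.elim fun _ h => h
  obtain ⟨r, hr, hrs⟩ := Metric.eventually_nhds_iff_ball.1
    ((eventually_nhdsWithin_iff.1 hpunct).and (hU.mem_nhds ha))
  have himg : f '' ball a r ∈ 𝓝 (f a) := hopen a ha (image_mem_map (ball_mem_nhds a hr))
  have hgdiff : DifferentiableOn ℂ g (f '' ball a r) := by
    refine (Complex.differentiableOn_compl_singleton_and_continuousAt_iff himg).1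
      ⟨?_, hgc a ha⟩
    rintro _ ⟨⟨x, hx, rfl⟩, hxa⟩
    refine (hgd x (hrs x hx).2 ((hrs x hx).1 fun h => hxa ?_)).differentiableWithinAt
    rw [h]; rfl
  have hg := (hgdiff.differentiableAt himg).hasDerivAt
  have hcomp := hg.comp a (hfa a ha).differentiableAt.hasDerivAt
  have hid : HasDerivAt (g ∘ f) 1 a := (hasDerivAt_id a).congr_of_eventuallyEq
    (eventually_of_mem (hU.mem_nhds ha) hgf)
  simpa [h0] using hcomp.unique hid

variable {E F : Type*} [NormedAddCommGroup E] [NormedSpace ℂ E] [FiniteDimensional ℂ E]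
  [NormedAddCommGroup F] [NormedSpace ℂ F] [FiniteDimensional ℂ F] {f : E → F} {U : Set E}

theorem fderiv_ne_zero_of_injOn_of_finrank_eq_one (hE : Module.finrank ℂ E = 1)
    (hF : Module.finrank ℂ F = 1) (hU : IsOpen U) (hf : DifferentiableOn ℂ f U)
    (hinj : InjOn f U) {a : E} (ha : a ∈ U) : fderiv ℂ f a ≠ 0 := by
  intro h0
  let A : ℂ ≃L[ℂ] E := ContinuousLinearEquiv.ofFinrankEq (by simp [hE])
  let B : F ≃L[ℂ] ℂ := ContinuousLinearEquiv.ofFinrankEq (by simp [hF])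
  refine deriv_ne_zero_of_injOn (f := fun z => B (f (A z))) (U := A ⁻¹' U) (a := A.symm a)
    (hU.preimage A.continuous) ?_ ?_ (by simpa using ha) ?_
  · exact B.differentiable.comp_differentiableOn
      (hf.comp A.differentiable.differentiableOn fun z hz => hz)
  · intro x hx y hy hxy
    exact A.injective (hinj hx hy (B.injective hxy))
  · have h1 : HasFDerivAt f (0 : E →L[ℂ] F) (A (A.symm a)) := by
      rw [A.apply_symm_apply, ← h0]
      exact (hf.differentiableAt (hU.mem_nhds ha)).hasFDerivAt
    have h2 := B.hasFDerivAt.comp_hasDerivAt (A.symm a)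
      (h1.comp_hasDerivAt (A.symm a) A.hasDerivAt)
    simpa [Function.comp_def] using h2.deriv

/-- These are the Taylor coefficients, up to factorials, of `h` along the line from `a` to `b`; if
all vanished, so would `h b`. -/
theorem exists_iterated_directional_deriv_ne_zero {h : E → ℂ} {a b : E} {r : ℝ}
    (hh : DifferentiableOn ℂ h (ball a r)) (hb : b ∈ ball a r) (hhb : h b ≠ 0) :
    ∃ j : ℕ, ((fun (φ : E → ℂ) x => fderiv ℂ φ x (b - a))^[j] h) a ≠ 0 := by
  by_contra! hall
  set T : (E → ℂ) → E → ℂ := fun φ x => fderiv ℂ φ x (b - a)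
  have hT : ∀ j, DifferentiableOn ℂ (T^[j] h) (ball a r) := fun j => by
    induction j with
    | zero => exact hh
    | succ j ih =>
      rw [Function.iterate_succ_apply']
      exact differentiableOn_fderiv_apply_const ih isOpen_ball _
  obtain hba | hne := eq_or_ne b a
  · exact hhb (by simpa [hba] using hall 0)
  have hne : 0 < ‖b - a‖ := norm_pos_iff.2 (sub_ne_zero.2 hne)
  set R := r / ‖b - a‖
  have hR1 : 1 < R := (one_lt_div hne).2 (by rwa [mem_ball, dist_eq_norm] at hb)
  have hmap : MapsTo (fun t : ℂ => a + t • (b - a)) (ball 0 R) (ball a r) := fun t ht => by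
    have ht' : ‖t‖ < R := by simpa using ht
    simpa [norm_smul] using (lt_div_iff₀ hne).1 ht'
  have hd : ∀ j, ∀ t ∈ ball (0 : ℂ) R,
      iteratedDeriv j (fun t : ℂ => h (a + t • (b - a))) t = (T^[j] h) (a + t • (b - a)) := by
    intro j
    induction j with
    | zero => intro t _; simp
    | succ j ih =>
      intro t ht
      rw [iteratedDeriv_succ, Function.iterate_succ_apply',
        EventuallyEq.deriv_eq (eventually_of_mem (isOpen_ball.mem_nhds ht) ih)]
      have h3 : HasDerivAt (fun z : ℂ => a + z • (b - a)) (b - a) t := by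
        simpa using ((hasDerivAt_id t).smul_const (b - a)).const_add a
      exact (((hT j).differentiableAt (isOpen_ball.mem_nhds (hmap ht))).hasFDerivAt.comp_hasDerivAt
        t h3).deriv
  have h1R : (1 : ℂ) ∈ ball (0 : ℂ) R := by simpa using hR1
  have htaylor := Complex.taylorSeries_eq_on_ball' h1R (hh.comp (by fun_prop) hmap)
  have h0R : (0 : ℂ) ∈ ball (0 : ℂ) R := mem_ball_self (by linarith)
  have hz : ∀ j, iteratedDeriv j (h ∘ fun t : ℂ => a + t • (b - a)) 0 = 0 := fun j => by
    have := hd j 0 h0R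
    rw [zero_smul, add_zero, hall j] at this
    exact this
  simp only [hz, mul_zero, zero_mul, tsum_zero, Function.comp_apply, one_smul,
    add_sub_cancel] at htaylor
  exact hhb htaylor.symm

/-- If the derivative of an injective holomorphic map is everywhere injective or zero, then it
does not vanish, in dimension at least two. -/
theorem fderiv_ne_zero_of_injOn_of_two_le_finrank (hE : 2 ≤ Module.finrank ℂ E)
    (hEF : Module.finrank ℂ E = Module.finrank ℂ F) (hU : IsOpen U) (hf : DifferentiableOn ℂ f U)
    (hinj : InjOn f U)
    (hdich : ∀ x ∈ U, Function.Injective (fderiv ℂ f x) ∨ fderiv ℂ f x = 0) {a : E} (ha : a ∈ U) :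
    fderiv ℂ f a ≠ 0 := by
  intro h0
  have hEn : Nontrivial E := Module.nontrivial_of_finrank_pos (R := ℂ) (by omega)
  let A : F ≃L[ℂ] E := ContinuousLinearEquiv.ofFinrankEq hEF.symm
  set h : E → ℂ := fun x =>
    LinearMap.det (((A : F →L[ℂ] E) ∘L fderiv ℂ f x : E →L[ℂ] E) : E →ₗ[ℂ] E)
  have hhd : DifferentiableOn ℂ h U := by
    have h1 : DifferentiableOn ℂ (fun x => (A : F →L[ℂ] E) ∘L fderiv ℂ f x) U :=
      (differentiableOn_const _).clm_comp (differentiableOn_fderiv_of_isOpen hf hU)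
    exact (ContinuousLinearMap.differentiable_det (E := E)).comp_differentiableOn h1
  have hzero : ∀ x ∈ U, h x = 0 ↔ fderiv ℂ f x = 0 := fun x hx => by
    refine ⟨fun hx0 => (hdich x hx).resolve_left fun hi => ?_, fun hx0 => by_contra fun hne => ?_⟩
    · exact (ContinuousLinearMap.det_ne_zero_iff_injective _).2 (A.injective.comp hi) hx0
    · have hi := (ContinuousLinearMap.det_ne_zero_iff_injective _).1 hne
      obtain ⟨v, hv⟩ := exists_ne (0 : E)
      exact hv (hi (by simp [hx0]))
  obtain ⟨r, hr, hrU⟩ := Metric.isOpen_iff.1 hU a ha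
  obtain ⟨b, hb, hhb⟩ : ∃ b ∈ ball a r, h b ≠ 0 := by
    by_contra! hall
    have hconst : ∀ y ∈ ball a r, f y = f a := fun y hy =>
      isOpen_ball.is_const_of_fderiv_eq_zero (convex_ball a r).isPreconnected (hf.mono hrU)
        (fun z hz => (hzero z (hrU hz)).1 (hall z hz)) hy (mem_ball_self hr)
    obtain ⟨y, hy, hya⟩ := exists_mem_ball_ne a hr
    exact hya (hinj (hrU hy) ha (hconst y hy))
  set T : (E → ℂ) → E → ℂ := fun φ x => fderiv ℂ φ x (b - a)
  have hT : ∀ j, DifferentiableOn ℂ (T^[j] h) U := fun j => by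
    induction j with
    | zero => exact hhd
    | succ j ih =>
      rw [Function.iterate_succ_apply']
      exact differentiableOn_fderiv_apply_const ih hU _
  -- Minimizing `j` over all zeros of `h` at once makes the previous iterate `φ` vanish on the whole
  -- zero set of `h`, while its derivative at `c` is nonzero. In straightened coordinates that zero
  -- set lies in the hyperplane `c + ker ℓ`.
  have hex : ∃ j, ∃ x ∈ U, h x = 0 ∧ (T^[j] h) x ≠ 0 := by
    obtain ⟨j, hj⟩ := exists_iterated_directional_deriv_ne_zero (hhd.mono hrU) hb hhb
    exact ⟨j, a, ha, (hzero a ha).2 h0, hj⟩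
  classical
  obtain ⟨c, hc, hc0, hcT⟩ := Nat.find_spec hex
  obtain ⟨m, hm⟩ : ∃ m, Nat.find hex = m + 1 := Nat.exists_eq_succ_of_ne_zero fun h0 => by
    rw [h0] at hcT
    exact hcT hc0
  set φ := T^[m] h
  have hφ0 : ∀ x ∈ U, h x = 0 → φ x = 0 := fun x hx hx0 => by
    by_contra hne
    exact Nat.find_min hex (m := m) (by omega) ⟨x, hx, hx0, hne⟩
  rw [hm, Function.iterate_succ_apply'] at hcT
  obtain ⟨ψ, W, hWo, hcW, hψd, hψU, hψi, hψc, -, hψφ⟩ := exists_straightening hU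
    (show DifferentiableOn ℂ φ U from hT m) hc hcT
  set ℓ := fderiv ℂ φ c
  set e := b - a
  have hcT' : ℓ e ≠ 0 := hcT
  have hline : ∀ (k : LinearMap.ker (ℓ : E →ₗ[ℂ] ℂ)) (t : ℂ), c + k + t • e ∈ W →
      h (ψ (c + k + t • e)) = 0 → t = 0 := fun k t hW h0 => by
    have h1 := hψφ _ hW
    rw [hφ0 _ (hψU hW) h0, hφ0 c hc hc0] at h1
    have h2 : ℓ k = 0 := k.2
    have h3 : ℓ (c + k + t • e - c) = t * ℓ e := by
      simp [h2]
    rw [h3, zero_add] at h1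
    exact (mul_eq_zero.1 h1.symm).resolve_right hcT'
  obtain ⟨ε, hε, hεW⟩ := Metric.isOpen_iff.1 hWo c hcW
  set ρ := ε / (2 * (‖e‖ + 1))
  have hρ : 0 < ρ := by positivity
  have hmemW : ∀ (k : LinearMap.ker (ℓ : E →ₗ[ℂ] ℂ)) (t : ℂ), ‖k‖ < ε / 2 → ‖t‖ ≤ ρ →
      c + k + t • e ∈ W := fun k t hk ht => hεW <| by
    rw [mem_ball, dist_eq_norm]
    calc ‖c + k + t • e - c‖ = ‖(k : E) + t • e‖ := by congr 1; abel
      _ ≤ ‖(k : E)‖ + ‖t • e‖ := norm_add_le _ _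
      _ ≤ ‖k‖ + ρ * (‖e‖ + 1) := by
        rw [norm_smul]
        have : ‖t‖ * ‖e‖ ≤ ρ * (‖e‖ + 1) := by gcongr; linarith
        simpa using this
      _ < ε / 2 + ρ * (‖e‖ + 1) := by gcongr
      _ = ε := by simp only [ρ]; field_simp; ring
  have hhψ : DifferentiableOn ℂ (fun y => h (ψ y)) W := hhd.comp hψd hψU
  have hsmall : ∀ᶠ k : LinearMap.ker (ℓ : E →ₗ[ℂ] ℂ) in 𝓝 0, ‖k‖ < ε / 2 := by
    filter_upwards [ball_mem_nhds (0 : LinearMap.ker (ℓ : E →ₗ[ℂ] ℂ)) (half_pos hε)] with k hk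
    simpa using hk
  have hdisc : ∀ k : LinearMap.ker (ℓ : E →ₗ[ℂ] ℂ), ‖k‖ < ε / 2 →
      DifferentiableOn ℂ (fun t : ℂ => h (ψ (c + k + t • e))) (closedBall 0 ρ) := fun k hk =>
    hhψ.comp (f := fun t : ℂ => c + k + t • e) (by fun_prop) fun t ht =>
      hmemW k t hk (by simpa using ht)
  have h00 : ‖(0 : LinearMap.ker (ℓ : E →ₗ[ℂ] ℂ))‖ < ε / 2 := by simpa using half_pos hε
  -- By Hurwitz every nearby disc transverse to the hyperplane carries a zero, which can only sit at
  -- `t = 0`. So `f'` vanishes along a piece of hypersurface of positive dimension and `f` is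
  -- constant there, against injectivity.
  have hvanish : ∀ᶠ k : LinearMap.ker (ℓ : E →ₗ[ℂ] ℂ) in 𝓝 0, h (ψ (c + k)) = 0 := by
    have hz := eventually_exists_zero_of_tendstoContinuouslyOn
      (l := 𝓝 (0 : LinearMap.ker (ℓ : E →ₗ[ℂ] ℂ)))
      (G := fun k t => h (ψ (c + k + t • e)))
      (g := fun t => h (ψ (c + (0 : LinearMap.ker (ℓ : E →ₗ[ℂ] ℂ)) + t • e))) (c := 0) hρ
      (hsmall.mono fun k hk => DifferentiableOn.diffContOnCl (by
        rw [closure_ball _ hρ.ne']; exact hdisc k hk))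
      (fun t ht => by
        rw [← nhds_prod_eq]
        have hW := hmemW 0 t h00 (by simpa using ht)
        exact ContinuousAt.comp (g := fun y => h (ψ y))
          (f := fun p : LinearMap.ker (ℓ : E →ₗ[ℂ] ℂ) × ℂ => c + p.1 + p.2 • e)
          (x := ((0 : LinearMap.ker (ℓ : E →ₗ[ℂ] ℂ)), t))
          (hhψ.continuousOn.continuousAt (hWo.mem_nhds hW)) (by fun_prop))
      ((hdisc 0 h00).continuousOn.mono sphere_subset_closedBall)
      (fun t ht h0 => ne_of_mem_sphere ht hρ.ne' (hline 0 t (hmemW 0 t h00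
        (by simpa using sphere_subset_closedBall ht)) h0))
      (by simpa [hψc] using hc0)
    filter_upwards [hz, hsmall] with k ⟨t, ht, hkt⟩ hk
    have ht0 := hline k t (hmemW k t hk (by simpa using ht)) hkt
    simpa [ht0] using hkt
  obtain ⟨δ, hδ, hδs⟩ := Metric.eventually_nhds_iff_ball.1 (hvanish.and hsmall)
  have hmW : ∀ k ∈ ball (0 : LinearMap.ker (ℓ : E →ₗ[ℂ] ℂ)) δ, c + (k : E) ∈ W := fun k hk => by
    simpa using hmemW k 0 (hδs k hk).2 (by simpa using hρ.le)
  have hqd : ∀ k ∈ ball (0 : LinearMap.ker (ℓ : E →ₗ[ℂ] ℂ)) δ,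
      HasFDerivAt (fun k : LinearMap.ker (ℓ : E →ₗ[ℂ] ℂ) => f (ψ (c + k))) 0 k := fun k hk => by
    have h1 : HasFDerivAt f (0 : E →L[ℂ] F) (ψ (c + k)) := by
      have hk' := hψU (hmW k hk)
      rw [← (hzero _ hk').1 (hδs k hk).1]
      exact (hf.differentiableAt (hU.mem_nhds hk')).hasFDerivAt
    have h2 : DifferentiableAt ℂ (fun k : LinearMap.ker (ℓ : E →ₗ[ℂ] ℂ) => ψ (c + k)) k :=
      (hψd.differentiableAt (hWo.mem_nhds (hmW k hk))).comp k
        (f := fun k : LinearMap.ker (ℓ : E →ₗ[ℂ] ℂ) => c + (k : E))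
        ((LinearMap.ker (ℓ : E →ₗ[ℂ] ℂ)).subtypeL.differentiableAt.const_add c)
    have h3 := h1.comp k h2.hasFDerivAt
    rw [ContinuousLinearMap.zero_comp] at h3
    exact h3
  have hK : Nontrivial (LinearMap.ker (ℓ : E →ₗ[ℂ] ℂ)) := by
    refine Module.nontrivial_of_finrank_pos (R := ℂ) ?_
    have h1 := LinearMap.finrank_range_add_finrank_ker (ℓ : E →ₗ[ℂ] ℂ)
    have h2 : Module.finrank ℂ (LinearMap.range (ℓ : E →ₗ[ℂ] ℂ)) ≤ 1 := by
      simpa using Submodule.finrank_le (LinearMap.range (ℓ : E →ₗ[ℂ] ℂ))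
    omega
  obtain ⟨k, hk, hk0⟩ := exists_mem_ball_ne (0 : LinearMap.ker (ℓ : E →ₗ[ℂ] ℂ)) hδ
  have hconst := isOpen_ball.is_const_of_fderiv_eq_zero (convex_ball _ _).isPreconnected
    (fun k hk => (hqd k hk).differentiableAt.differentiableWithinAt)
    (fun k hk => (hqd k hk).fderiv) hk (mem_ball_self hδ)
  have h1 := hψi (hmW k hk) (hmW 0 (mem_ball_self hδ)) (hinj (hψU (hmW k hk))
    (hψU (hmW 0 (mem_ball_self hδ))) hconst)
  exact hk0 (Subtype.ext (add_left_cancel h1))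

end Osgood

/-! ### Osgood's theorem by induction on the dimension. -/

section OsgoodInduction

universe u v

/-- Osgood's theorem: the derivative of an injective holomorphic map between spaces of the same
dimension is invertible. -/
theorem injective_fderiv_of_injOn (n : ℕ) : ∀ {E : Type u} {F : Type v} [NormedAddCommGroup E]
    [NormedSpace ℂ E] [FiniteDimensional ℂ E] [NormedAddCommGroup F] [NormedSpace ℂ F]
    [FiniteDimensional ℂ F], Module.finrank ℂ E = n → Module.finrank ℂ F = n →
    ∀ {f : E → F} {U : Set E}, IsOpen U → DifferentiableOn ℂ f U → InjOn f U → ∀ a ∈ U,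
      Function.Injective (fderiv ℂ f a) := by
  induction n with
  | zero =>
    intro E F _ _ _ _ _ _ hE _ f U _ _ _ a _
    have : Subsingleton E := Module.finrank_zero_iff.1 hE
    exact Function.injective_of_subsingleton _
  | succ m ih =>
    intro E F _ _ _ _ _ _ hE hF f U hU hf hinj
    -- If `f'(a) ≠ 0`, some functional `q` has `q ∘ f'(a) ≠ 0`. After straightening `q ∘ f`, the map
    -- `f` sends the slice `a + ker ℓ` injectively into a translate of `ker q`, one dimension lower.
    -- Any `v` killed by `f'(a)` is tangent to this slice, so the induction hypothesis gives `v =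
    -- 0`.
    have hdich : ∀ x ∈ U, Function.Injective (fderiv ℂ f x) ∨ fderiv ℂ f x = 0 := by
      intro a ha
      refine or_iff_not_imp_right.2 fun hne => (injective_iff_map_eq_zero _).2 fun v hv => ?_
      obtain ⟨w, hw⟩ : ∃ w, fderiv ℂ f a w ≠ 0 := by
        by_contra! hall
        exact hne (ContinuousLinearMap.ext hall)
      obtain ⟨q, hq⟩ := SeparatingDual.exists_ne_zero (R := ℂ) hw
      have hfa := (hf.differentiableAt (hU.mem_nhds ha)).hasFDerivAt
      have hqf : HasFDerivAt (fun x => q (f x)) (q ∘L fderiv ℂ f a) a := q.hasFDerivAt.comp a hfa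
      obtain ⟨ψ, W, hWo, haW, hψd, hψU, hψi, hψa, hψ', hψq⟩ := exists_straightening hU
        (q.differentiable.comp_differentiableOn hf) ha (e := w)
        (by rw [Function.comp_def, hqf.fderiv]; exact hq)
      simp only [Function.comp_def, hqf.fderiv] at hψq
      set ℓ : E →L[ℂ] ℂ := q ∘L fderiv ℂ f a
      -- The projection `P` only serves to give the slice map the codomain `ker q`; on its values it
      -- is the identity.
      obtain ⟨P, hP⟩ := Submodule.ClosedComplemented.of_finiteDimensional
        (LinearMap.ker (q : F →ₗ[ℂ] ℂ)) (𝕜 := ℂ)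
      have hkerE : Module.finrank ℂ (LinearMap.ker (ℓ : E →ₗ[ℂ] ℂ)) = m := by
        have h1 := Module.Dual.finrank_ker_add_one_of_ne_zero (f := (ℓ : E →ₗ[ℂ] ℂ))
          fun h => hq (by simpa [ℓ] using LinearMap.congr_fun h w)
        omega
      have hkerF : Module.finrank ℂ (LinearMap.ker (q : F →ₗ[ℂ] ℂ)) = m := by
        have h1 := Module.Dual.finrank_ker_add_one_of_ne_zero (f := (q : F →ₗ[ℂ] ℂ))
          fun h => hq (by simpa using LinearMap.congr_fun h (fderiv ℂ f a w))
        omega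
      set N : Set (LinearMap.ker (ℓ : E →ₗ[ℂ] ℂ)) := {k | a + (k : E) ∈ W}
      have hker : ∀ k ∈ N, f (ψ (a + k)) - f a ∈ LinearMap.ker (q : F →ₗ[ℂ] ℂ) := fun k hk => by
        have h1 := hψq _ hk
        have h2 : ℓ k = 0 := k.2
        rw [add_sub_cancel_left, h2, add_zero] at h1
        simp [h1]
      have hNd : ∀ k ∈ N, DifferentiableAt ℂ (fun k : LinearMap.ker (ℓ : E →ₗ[ℂ] ℂ) =>
          f (ψ (a + k)) - f a) k := fun k hk => by
        have h2 : DifferentiableAt ℂ (fun k : LinearMap.ker (ℓ : E →ₗ[ℂ] ℂ) => ψ (a + k)) k :=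
          (hψd.differentiableAt (hWo.mem_nhds hk)).comp k
            (f := fun k : LinearMap.ker (ℓ : E →ₗ[ℂ] ℂ) => a + (k : E))
            ((LinearMap.ker (ℓ : E →ₗ[ℂ] ℂ)).subtypeL.differentiableAt.const_add a)
        exact ((hf.differentiableAt (hU.mem_nhds (hψU hk))).comp k h2).sub_const _
      have h0N : (0 : LinearMap.ker (ℓ : E →ₗ[ℂ] ℂ)) ∈ N := by simpa [N] using haW
      have hslice := ih hkerE hkerF (f := fun k => P (f (ψ (a + k)) - f a)) (U := N)
        (hWo.preimage (by fun_prop))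
        (fun k hk => (P.differentiableAt.comp k (hNd k hk)).differentiableWithinAt)
        (fun k hk k' hk' hkk => by
          have h1 := congrArg (Subtype.val) hkk
          simp only at h1
          rw [hP ⟨_, hker k hk⟩, hP ⟨_, hker k' hk'⟩] at h1
          have h2 := hinj (hψU hk) (hψU hk') (sub_left_injective h1)
          exact Subtype.ext (add_left_cancel (hψi hk hk' h2))) 0 h0N
      have hvk : v ∈ LinearMap.ker (ℓ : E →ₗ[ℂ] ℂ) := by simp [ℓ, hv]
      have hder : HasFDerivAt (fun k : LinearMap.ker (ℓ : E →ₗ[ℂ] ℂ) => P (f (ψ (a + k)) - f a))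
          (P ∘L (fderiv ℂ f a ∘L (LinearMap.ker (ℓ : E →ₗ[ℂ] ℂ)).subtypeL)) 0 := by
        refine P.hasFDerivAt.comp _ (HasFDerivAt.sub_const _ ?_)
        have h1 : HasFDerivAt (fun k : LinearMap.ker (ℓ : E →ₗ[ℂ] ℂ) => a + (k : E))
            (LinearMap.ker (ℓ : E →ₗ[ℂ] ℂ)).subtypeL 0 :=
          (LinearMap.ker (ℓ : E →ₗ[ℂ] ℂ)).subtypeL.hasFDerivAt.const_add a
        have h2 : HasFDerivAt ψ (ContinuousLinearMap.id ℂ E)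
            (a + ((0 : LinearMap.ker (ℓ : E →ₗ[ℂ] ℂ)) : E)) := by simpa using hψ'
        have h3 : HasFDerivAt f (fderiv ℂ f a)
            (ψ (a + ((0 : LinearMap.ker (ℓ : E →ₗ[ℂ] ℂ)) : E))) := by simpa [hψa] using hfa
        have h4 := h2.comp (0 : LinearMap.ker (ℓ : E →ₗ[ℂ] ℂ)) h1
        rw [ContinuousLinearMap.id_comp] at h4
        exact h3.comp (0 : LinearMap.ker (ℓ : E →ₗ[ℂ] ℂ)) h4
      rw [hder.fderiv] at hslice
      have := @hslice ⟨v, hvk⟩ 0 (by simp [hv])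
      exact congrArg Subtype.val this
    intro a ha
    refine (hdich a ha).resolve_right ?_
    obtain rfl | hm := Nat.eq_zero_or_pos m
    · exact fderiv_ne_zero_of_injOn_of_finrank_eq_one hE hF hU hf hinj ha
    · exact fderiv_ne_zero_of_injOn_of_two_le_finrank (by omega) (hE.trans hF.symm) hU hf hinj
        hdich ha

end OsgoodInduction

/-! ### Limits of injective holomorphic maps. -/

section LimitsOfInjectiveMaps

variable {E : Type*} [NormedAddCommGroup E] [NormedSpace ℂ E] [FiniteDimensional ℂ E]
  {f : E → E} {D W : Set E}

theorem exists_hasStrictFDerivAt_equiv {x : E} (hD : IsOpen D) (hf : DifferentiableOn ℂ f D)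
    (hx : x ∈ D) (hinj : Function.Injective (fderiv ℂ f x)) :
    ∃ B : E ≃L[ℂ] E, HasStrictFDerivAt f (B : E →L[ℂ] E) x := by
  obtain ⟨B, hB⟩ := (fderiv ℂ f x).exists_equiv_of_injective hinj rfl
  exact ⟨B, hB ▸ (hf.contDiffAt_one hD hx).hasStrictFDerivAt one_ne_zero⟩

theorem differentiableOn_invFunOn_image (hD : IsOpen D) (hf : DifferentiableOn ℂ f D)
    (hinj : InjOn f D) : DifferentiableOn ℂ (Function.invFunOn f D) (f '' D) := by
  have : CompleteSpace E := FiniteDimensional.complete ℂ E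
  rintro _ ⟨x, hx, rfl⟩
  obtain ⟨B, hB⟩ := exists_hasStrictFDerivAt_equiv hD hf hx
    (injective_fderiv_of_injOn _ rfl rfl hD hf hinj x hx)
  exact (hB.to_local_left_inverse (eventually_of_mem (hD.mem_nhds hx)
    fun y hy => hinj.leftInvOn_invFunOn hy)).hasFDerivAt.differentiableAt.differentiableWithinAt

theorem isOpen_image_of_injective_fderiv (hD : IsOpen D) (hf : DifferentiableOn ℂ f D)
    (hinj : ∀ x ∈ D, Function.Injective (fderiv ℂ f x)) : IsOpen (f '' D) := by
  have : CompleteSpace E := FiniteDimensional.complete ℂ E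
  refine isOpen_iff_mem_nhds.2 ?_
  rintro _ ⟨x, hx, rfl⟩
  obtain ⟨B, hB⟩ := exists_hasStrictFDerivAt_equiv hD hf hx (hinj x hx)
  rw [← hB.map_nhds_eq_of_equiv]
  exact image_mem_map (hD.mem_nhds hx)

variable {ι : Type*} {F : ι → E → E}

/-- Hurwitz's theorem for the Jacobian determinants of a convergent family. -/
theorem injective_fderiv_of_tendstoContinuouslyOn {l : Filter ι} [l.NeBot] (hD : IsOpen D)
    (hDc : IsPreconnected D) (hF : ∀ k, DifferentiableOn ℂ (F k) D)
    (hFinj : ∀ᶠ k in l, InjOn (F k) D) (hf : DifferentiableOn ℂ f D)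
    (hFf : TendstoContinuouslyOn (fun k => fderiv ℂ (F k)) (fderiv ℂ f) l D) {z : E} (hz : z ∈ D)
    (hfz : Function.Injective (fderiv ℂ f z)) : ∀ x ∈ D, Function.Injective (fderiv ℂ f x) := by
  have hdet := ContinuousLinearMap.differentiable_det (E := E)
  have h := ne_zero_of_tendstoContinuouslyOn hD hDc
    (fun k => hdet.comp_differentiableOn (differentiableOn_fderiv_of_isOpen (hF k) hD))
    (hFinj.mono fun k hk x hx => (ContinuousLinearMap.det_ne_zero_iff_injective _).2
      (injective_fderiv_of_injOn _ rfl rfl hD (hF k) hk x hx))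
    (hdet.comp_differentiableOn (differentiableOn_fderiv_of_isOpen hf hD))
    (hFf.continuous_comp hdet.continuous) hz
    ((ContinuousLinearMap.det_ne_zero_iff_injective _).2 hfz)
  exact fun x hx => (ContinuousLinearMap.det_ne_zero_iff_injective _).1 (h x hx)

/-- If the limit took one value at two points, some injective `F k` would take it in disjoint
neighbourhoods of both. -/
theorem injOn_of_tendstoContinuouslyOn {l : Filter ι} [l.NeBot] (hD : IsOpen D)
    (hF : ∀ k, DifferentiableOn ℂ (F k) D) (hFinj : ∀ᶠ k in l, InjOn (F k) D)
    (hFf : TendstoContinuouslyOn F f l D)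
    (hFf' : TendstoContinuouslyOn (fun k => fderiv ℂ (F k)) (fderiv ℂ f) l D)
    (hf' : ∀ x ∈ D, Function.Injective (fderiv ℂ f x)) : InjOn f D := by
  intro p hp q hq hpq
  by_contra hne
  obtain ⟨V, V', hV, hV', hdisj⟩ := t2_separation_nhds hne
  have h1 := eventually_mem_image_of_tendstoContinuouslyOn hD hF hFf hFf' hp (hf' p hp)
    (inter_mem hV (hD.mem_nhds hp))
  have h2 := eventually_mem_image_of_tendstoContinuouslyOn hD hF hFf hFf' hq (hf' q hq)
    (inter_mem hV' (hD.mem_nhds hq))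
  obtain ⟨k, ⟨⟨x, hx, hkx⟩, ⟨y, hy, hky⟩⟩, hk⟩ := ((h1.and h2).and hFinj).exists
  have hxy : x = y := hk hx.2 hy.2 (by rw [hkx, hky, hpq])
  exact hdisj.ne_of_mem hx.1 hy.1 hxy

/-- A limit of injective holomorphic maps whose images eventually contain a fixed connected
neighbourhood `W` of a value of the limit has invertible derivatives, and its image
contains `W`. -/
theorem injective_fderiv_and_subset_image_of_tendstoContinuouslyOn (l : Ultrafilter ι)
    (hD : IsOpen D) (hDc : IsPreconnected D) (hDb : Bornology.IsBounded D)
    (hF : ∀ k, DifferentiableOn ℂ (F k) D) (hFinj : ∀ k, InjOn (F k) D)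
    (hf : DifferentiableOn ℂ f D) (hFf : TendstoContinuouslyOn F f l D)
    (hFf' : TendstoContinuouslyOn (fun k => fderiv ℂ (F k)) (fderiv ℂ f) l D)
    (hW : IsOpen W) (hWc : IsPreconnected W) (hWF : ∀ᶠ k in l, W ⊆ F k '' D) {z : E}
    (hz : z ∈ D) (hfz : f z ∈ W) :
    (∀ x ∈ D, Function.Injective (fderiv ℂ f x)) ∧ W ⊆ f '' D := by
  classical
  -- The constant default keeps every `G k` holomorphic on `W` with values in `D`, as Montel's
  -- theorem requires of all indices.
  set G : ι → E → E := fun k => if W ⊆ F k '' D then Function.invFunOn (F k) D else fun _ => z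
  have hGF : ∀ k, W ⊆ F k '' D → G k = Function.invFunOn (F k) D := fun k hk => if_pos hk
  have hGd : ∀ k, DifferentiableOn ℂ (G k) W := fun k => by
    by_cases hk : W ⊆ F k '' D
    · rw [hGF k hk]
      exact (differentiableOn_invFunOn_image hD (hF k) (hFinj k)).mono hk
    · simp only [G, if_neg hk]
      exact differentiableOn_const _
  have hGD : ∀ k, ∀ w ∈ W, G k w ∈ D := fun k w hw => by
    by_cases hk : W ⊆ F k '' D
    · rw [hGF k hk]
      exact Function.invFunOn_mem (hk hw)
    · simpa only [G, if_neg hk] using hz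
  have hFG : ∀ k, W ⊆ F k '' D → ∀ w ∈ W, F k (G k w) = w := fun k hk w hw => by
    rw [hGF k hk]
    exact Function.invFunOn_eq (hk hw)
  obtain ⟨M, hM⟩ := hDb.exists_norm_le
  obtain ⟨g, hg, hGg, hGg'⟩ := exists_tendstoContinuouslyOn_fderiv l hW hGd
    (fun k w hw => hM _ (hGD k w hw))
  have hgf : ∀ᶠ x in 𝓝 z, g (f x) = x := by
    have hfc := hf.continuousOn.continuousAt (hD.mem_nhds hz)
    filter_upwards [hfc.eventually_mem (hW.mem_nhds hfz), hD.mem_nhds hz] with x hxW hxD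
    refine tendsto_nhds_unique (hGg.tendsto_of_tendsto hxW (hFf.tendsto hxD)) ?_
    refine tendsto_const_nhds.congr' ?_
    filter_upwards [hWF, (hFf.tendsto hxD).eventually_mem (hW.mem_nhds hxW)] with k hk hkx
    exact (hFinj k (hGD k _ hkx) hxD (hFG k hk _ hkx)).symm
  have hcomp : (fderiv ℂ g (f z)) ∘L (fderiv ℂ f z) = ContinuousLinearMap.id ℂ E := by
    have h1 := (hg.differentiableAt (hW.mem_nhds hfz)).hasFDerivAt.comp z
      (hf.differentiableAt (hD.mem_nhds hz)).hasFDerivAt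
    exact h1.unique ((hasFDerivAt_id z).congr_of_eventuallyEq hgf)
  have hleft : Function.LeftInverse (fderiv ℂ g (f z)) (fderiv ℂ f z) := fun v => by
    simpa using congrArg (fun L : E →L[ℂ] E => L v) hcomp
  have hginj : Function.Injective (fderiv ℂ g (f z)) :=
    (LinearMap.injective_iff_surjective (f := (fderiv ℂ g (f z) : E →ₗ[ℂ] E))).2 hleft.surjective
  have hg' := injective_fderiv_of_tendstoContinuouslyOn hW hWc hGd
    (hWF.mono fun k hk w hw w' hw' h => by rw [← hFG k hk w hw, h, hFG k hk w' hw'])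
    hg hGg' hfz hginj
  refine ⟨injective_fderiv_of_tendstoContinuouslyOn hD hDc hF (Eventually.of_forall hFinj) hf hFf'
    hz hleft.injective, fun w hw => ?_⟩
  -- A limit of points of `D` need only lie in its closure; but `g'(w)` is invertible, so some `G k`
  -- attains the value `g w`.
  have hgw : g w ∈ D := by
    obtain ⟨k, x, hx, hkx⟩ := (eventually_mem_image_of_tendstoContinuouslyOn hW hGd hGg hGg' hw
      (hg' w hw) (hW.mem_nhds hw)).exists
    exact hkx ▸ hGD k x hx
  refine ⟨g w, hgw, tendsto_nhds_unique (hFf.tendsto_of_tendsto hgw (hGg.tendsto hw)) ?_⟩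
  exact tendsto_const_nhds.congr' (hWF.mono fun k hk => (hFG k hk w hw).symm)

end LimitsOfInjectiveMaps

/-! ### Minkowski balls and the extremal map. -/

theorem isOpen_minkowskiBall {n : ℕ} {Ω : Set (EuclideanSpace ℂ (Fin n))} (hΩ_open : IsOpen Ω)
    (hΩ_conv : Convex ℝ Ω) (h0 : 0 ∈ Ω) (r : ℝ) : IsOpen (minkowskiBall Ω r) :=
  isOpen_lt (continuous_gauge hΩ_conv (hΩ_open.mem_nhds h0)) continuous_const

theorem convex_minkowskiBall {n : ℕ} {Ω : Set (EuclideanSpace ℂ (Fin n))} (hΩ_open : IsOpen Ω)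
    (hΩ_conv : Convex ℝ Ω) (h0 : 0 ∈ Ω) (r : ℝ) : Convex ℝ (minkowskiBall Ω r) := by
  intro x hx y hy a b ha hb hab
  have h1 := gauge_add_le hΩ_conv (absorbent_nhds_zero (hΩ_open.mem_nhds h0)) (a • x) (b • y)
  rw [gauge_smul_of_nonneg ha, gauge_smul_of_nonneg hb] at h1
  exact h1.trans_lt (convex_Iio r hx hy ha hb hab)

theorem mainTheorem5 (n : ℕ) (D Ω : Set (EuclideanSpace ℂ (Fin n)))
    (hD_open : IsOpen D) (hD_conn : IsConnected D) (hD_bdd : Bornology.IsBounded D)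
    (hΩ_open : IsOpen Ω) (hΩ_nonempty : Ω.Nonempty) (hΩ_bdd : Bornology.IsBounded Ω)
    (hΩ_bal : Balanced ℂ Ω) (hΩ_conv : Convex ℝ Ω)
    (z : EuclideanSpace ℂ (Fin n)) (hz : z ∈ D) :
    ∃ f : EuclideanSpace ℂ (Fin n) → EuclideanSpace ℂ (Fin n), IsExtremalMap D Ω z f := by
  have h0 : (0 : EuclideanSpace ℂ (Fin n)) ∈ Ω := by
    obtain ⟨x, hx⟩ := hΩ_nonempty
    simpa using hΩ_bal.smul_mem (a := (0 : ℂ)) (by simp) hx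
  have hlub := isLUB_genSqueezing hD_open hD_bdd hΩ_open hΩ_nonempty hΩ_bdd hΩ_bal hz
  set s := genSqueezing D Ω z
  have hne : (squeezingRadii D Ω z).Nonempty := by
    by_contra h
    rw [not_nonempty_iff_eq_empty.1 h, isLUB_empty_iff] at hlub
    exact absurd (hlub (s - 1)) (by simp)
  have hs : 0 < s := hne.elim fun r hr => hr.1.trans_le (hlub.1 hr)
  obtain ⟨u, -, -, hu, hur⟩ := hlub.exists_seq_monotone_tendsto hne
  choose F hF using fun k => (hur k).2.2
  obtain ⟨M, hM⟩ := hΩ_bdd.exists_norm_le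
  set l : Ultrafilter ℕ := hyperfilter ℕ
  have hl : (l : Filter ℕ) ≤ atTop := Nat.hyperfilter_le_atTop
  obtain ⟨f, hf, hFf, hFf'⟩ := exists_tendstoContinuouslyOn_fderiv l hD_open
    (fun k => (hF k).1.differentiableOn) (fun k x hx => hM _ ((hF k).1.mapsTo hx))
  have hfz : f z = 0 := tendsto_nhds_unique (hFf.tendsto hz)
    (tendsto_const_nhds.congr fun k => (hF k).2.1.symm)
  have hkey : ∀ r, 0 < r → r < s →
      (∀ x ∈ D, Function.Injective (fderiv ℂ f x)) ∧ minkowskiBall Ω r ⊆ f '' D := fun r hr hrs =>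
    injective_fderiv_and_subset_image_of_tendstoContinuouslyOn l hD_open hD_conn.isPreconnected
      hD_bdd (fun k => (hF k).1.differentiableOn) (fun k => (hF k).1.injOn) hf hFf hFf'
      (isOpen_minkowskiBall hΩ_open hΩ_conv h0 r)
      (convex_minkowskiBall hΩ_open hΩ_conv h0 r).isPreconnected
      (((hu.eventually_const_lt hrs).filter_mono hl).mono fun k hk w hw => (hF k).2.2 (lt_trans hw hk)) hz
      (by simpa [minkowskiBall, hfz] using hr)
  -- Any radius strictly between `0` and `s` would do.
  have hf' := (hkey (s / 2) (half_pos hs) (half_lt_self hs)).1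
  refine ⟨f, ⟨hf, injOn_of_tendstoContinuouslyOn hD_open (fun k => (hF k).1.differentiableOn)
    (Eventually.of_forall fun k => (hF k).1.injOn) hFf hFf' hf', fun x hx => ?_⟩, hfz,
    fun w hw => ?_⟩
  -- The limit maps a priori only into the closure; its image is open, and an open convex set is the
  -- interior of its closure.
  · have hcl : f '' D ⊆ closure Ω := by
      rintro _ ⟨y, hy, rfl⟩
      exact mem_closure_of_tendsto (hFf.tendsto hy)
        (Eventually.of_forall fun k => (hF k).1.mapsTo hy)
    have hint := interior_maximal hcl (isOpen_image_of_injective_fderiv hD_open hf hf')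
      (mem_image_of_mem f hx)
    rwa [hΩ_conv.interior_closure_eq_interior_of_nonempty_interior
      (by rwa [hΩ_open.interior_eq]), hΩ_open.interior_eq] at hint
  · obtain ⟨r, hwr, hrs⟩ := exists_between (show gauge Ω w < s from hw)
    exact (hkey r ((gauge_nonneg w).trans_lt hwr) hrs).2 hwr
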